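/- Let $K$ be an algebraically closed field of characteristic $3$. A projective variety over $K$ is understood to be reduced and irreducible. For a very ample line bundle $A$ on a projective variety $X$, let $I(X,A)$ denote the homogeneous ideal of $X$ in the embedding $X\subset\mathbb P(H^0(X,A))$ given by the complete linear series $|A|$. Say that $(X,A)$ satisfies property $\mathsf{QR}(k)$ if $I(X,A)$ is generated by quadratic forms of rank at most $k$; if $I(X,A)$ is generated by quadratic forms, let $\operatorname{rank-index}(X,A)$ be the least integer $k$ for which $(X,A)$ satisfies $\mathsf{QR}(k)$. (An equality $\operatorname{rank-index}(X,A)=3$ includes the assertion that $I(X,A)$ is generated by quadratic forms.) (1) $\operatorname{rank-index}(\mathbb P^n,\mathcal O_{\mathbb P^n}(d))=3$ for all $n\ge 2$ and $d\ge 3$. (2) Let $X$ be a projective variety over $K$ of positive dimension and let $L$ be a very ample line bundle on $X$, defining the linearly normal embedding $X\subset\mathbb P^r$, $r=h^0(X,L)-1$. Let $m\ge 3$ be an integer such that $X\subset\mathbb P^r$ is $j$-normal for all $j\ge m$ (that is, the restriction map $H^0(\mathbb P^r,\mathcal O_{\mathbb P^r}(j))\to H^0(X,L^{j})$ is surjective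 for all $j\ge m$) and $I(X,L)$ is generated by forms of degree at most $m$. Then $$\operatorname{rank-index}(X,L^d)=3\quad\text{for all } d\ge m .$$ -/

import Mathlib

open scoped LinearAlgebra.Projectivization

/-- The points of projective `r`-space over `K`. -/
abbrev PSpace (K : Type*) [Field K] (r : ℕ) : Type _ := ℙ K (Fin (r + 1) → K)

section Varieties

variable {K : Type*} [Field K] {r : ℕ}

/-- The punctured affine cone over a set of points of projective space: all coordinate vectors
of all points of `X`. -/
def affineCone (X : Set (PSpace K r)) : Set (Fin (r + 1) → K) :=
  {v | ∃ h : v ≠ 0, Projectivization.mk K v h ∈ X}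

/-- Zariski closed subsets of projective space: the common zero loci of sets of forms. -/
def IsZariskiClosed (X : Set (PSpace K r)) : Prop :=
  ∃ S : Set (MvPolynomial (Fin (r + 1)) K),
    (∀ F ∈ S, ∃ e : ℕ, F.IsHomogeneous e) ∧
      X = {p | ∀ F ∈ S, ∀ v ∈ affineCone {p}, MvPolynomial.eval v F = 0}

/-- A projective variety over an algebraically closed field, as an embedded object: a nonempty
irreducible Zariski closed subset of projective space (with its reduced structure). -/
structure IsProjectiveVariety (X : Set (PSpace K r)) : Prop where
  closed : IsZariskiClosed X
  nonempty : X.Nonempty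
  irreducible : ∀ Y Z : Set (PSpace K r), IsZariskiClosed Y → IsZariskiClosed Z →
    X ⊆ Y ∪ Z → X ⊆ Y ∨ X ⊆ Z

/-- The homogeneous ideal of a set of points of projective space: the polynomials that vanish at
all coordinate vectors of all its points. (Over an infinite field this ideal is homogeneous.) -/
def homogeneousIdeal (X : Set (PSpace K r)) : Ideal (MvPolynomial (Fin (r + 1)) K) where
  carrier := {F | ∀ v ∈ affineCone X, MvPolynomial.eval v F = 0}
  add_mem' := by
    intro F G hF hG v hv
    rw [map_add, hF v hv, hG v hv, add_zero]
  zero_mem' := by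
    intro v _
    exact map_zero _
  smul_mem' := by
    intro c F hF v hv
    rw [smul_eq_mul, map_mul, hF v hv, mul_zero]

/-- The space `H⁰(X, O_X(j))` of global sections of the `j`-th power of the hyperplane bundle of
`X ⊂ ℙ^r`: the functions on the punctured affine cone of `X` which, near every point, are a
quotient `F / G` of two forms with `deg F = deg G + j` and `G` nowhere zero. -/
def sections (X : Set (PSpace K r)) (j : ℕ) : Submodule K (affineCone X → K) where
  carrier := {s | ∀ v : affineCone X, ∃ (e : ℕ) (F G : MvPolynomial (Fin (r + 1)) K),
    F.IsHomogeneous (e + j) ∧ G.IsHomogeneous e ∧ MvPolynomial.eval v.1 G ≠ 0 ∧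
      ∀ w : affineCone X, MvPolynomial.eval w.1 G ≠ 0 →
        s w = MvPolynomial.eval w.1 F / MvPolynomial.eval w.1 G}
  add_mem' := by
    intro s t hs ht v
    obtain ⟨e, F, G, hF, hG, hv, h⟩ := hs v
    obtain ⟨e', F', G', hF', hG', hv', h'⟩ := ht v
    refine ⟨e + e', F * G' + G * F', G * G', ?_, hG.mul hG', ?_, ?_⟩
    · refine MvPolynomial.IsHomogeneous.add ?_ ?_
      · convert hF.mul hG' using 1
        omega
      · convert hG.mul hF' using 1
        omega
    · rw [map_mul]
      exact mul_ne_zero hv hv'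
    · intro w hw
      rw [map_mul] at hw
      have h1 := left_ne_zero_of_mul hw
      have h2 := right_ne_zero_of_mul hw
      rw [Pi.add_apply, h w h1, h' w h2, div_add_div _ _ h1 h2]
      simp only [map_add, map_mul]
  zero_mem' := by
    intro v
    refine ⟨0, 0, 1, MvPolynomial.isHomogeneous_zero _ _ _, MvPolynomial.isHomogeneous_one _ _,
      ?_, ?_⟩
    · simp
    · intro w _
      simp
  smul_mem' := by
    intro c s hs v
    obtain ⟨e, F, G, hF, hG, hv, h⟩ := hs v
    refine ⟨e, MvPolynomial.C c * F, G, hF.C_mul c, hG, hv, ?_⟩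
    intro w hw
    rw [Pi.smul_apply, h w hw, smul_eq_mul, map_mul, MvPolynomial.eval_C, mul_div_assoc]

/-- The restriction map `H⁰(ℙ^r, O(j)) → H⁰(X, O_X(j))` on forms of degree `j`. -/
noncomputable def restrictForms (X : Set (PSpace K r)) (j : ℕ) :
    MvPolynomial.homogeneousSubmodule (Fin (r + 1)) K j →ₗ[K] sections X j where
  toFun F := ⟨fun v => MvPolynomial.eval v.1 F.1, fun v =>
    ⟨0, F.1, 1, by
      rw [zero_add]
      exact F.2, MvPolynomial.isHomogeneous_one _ _, by simp, fun w _ => by simp⟩⟩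
  map_add' := by
    intro F G
    ext v
    simp
  map_smul' := by
    intro c F
    ext v
    simp [MvPolynomial.smul_eval]

/-- `X ⊂ ℙ^r` is `j`-normal: forms of degree `j` cut out a complete linear series on `X`. -/
def IsNormalInDegree (X : Set (PSpace K r)) (j : ℕ) : Prop :=
  Function.Surjective (restrictForms X j)

/-- `X ⊂ ℙ^r` is embedded by the complete linear series of its hyperplane bundle `L = O_X(1)`:
the restriction `H⁰(ℙ^r, O(1)) → H⁰(X, L)` is an isomorphism. -/
def IsLinearlyNormallyEmbedded (X : Set (PSpace K r)) : Prop :=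
  Function.Bijective (restrictForms X 1)

/-- `I(X)` is generated by forms of degree at most `m`. -/
def IdealGeneratedInDegreeLE (X : Set (PSpace K r)) (m : ℕ) : Prop :=
  homogeneousIdeal X =
    Ideal.span {F | F ∈ homogeneousIdeal X ∧ ∃ e ≤ m, F.IsHomogeneous e}

/-- The polynomial `q` is the quadratic form of a symmetric matrix of rank `ρ`.
(The matrix is unique when `2` is invertible in `K`.) -/
def IsQuadricOfRank (q : MvPolynomial (Fin (r + 1)) K) (ρ : ℕ) : Prop :=
  ∃ A : Matrix (Fin (r + 1)) (Fin (r + 1)) K, A.IsSymm ∧ A.rank = ρ ∧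
    q = ∑ i, ∑ j, MvPolynomial.C (A i j) * (MvPolynomial.X i * MvPolynomial.X j)

/-- Property `QR(k)` of a subset of projective space: its homogeneous ideal is generated by
quadrics of rank at most `k`. -/
def PropertyQR (Y : Set (PSpace K r)) (k : ℕ) : Prop :=
  homogeneousIdeal Y =
    Ideal.span {q | q ∈ homogeneousIdeal Y ∧ ∃ ρ ≤ k, IsQuadricOfRank q ρ}

/-- The image of `X` under the map `X → ℙ^N`, `p ↦ [s₀(p) : ⋯ : s_N(p)]`, given by sections
`s₀, …, s_N` of `O_X(d)`. -/
def imageBySections (X : Set (PSpace K r)) {d N : ℕ} (s : Fin (N + 1) → sections X d) :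
    Set (PSpace K N) :=
  {q | ∃ v : affineCone X, ∃ h : (fun i => (s i).1 v) ≠ 0,
    q = Projectivization.mk K (fun i => (s i).1 v) h}

/-- `rank-index(X, L^d) = k`, where `L = O_X(1)`: the space `H⁰(X, L^d)` is nonzero and finite
dimensional and, in the embedding of `X` by the complete linear series `|L^d|` (with respect to
any basis of sections), `k` is the smallest integer for which property `QR(k)` holds. In
particular the ideal of this embedding is generated by quadrics. -/
def HasRankIndex (X : Set (PSpace K r)) (d k : ℕ) : Prop :=
  (∃ N : ℕ, Nonempty (Module.Basis (Fin (N + 1)) K (sections X d))) ∧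
    ∀ (N : ℕ) (b : Module.Basis (Fin (N + 1)) K (sections X d)),
      IsLeast {i : ℕ | PropertyQR (imageBySections X b) i} k

end Varieties

/-! Write `lam F` for the linear form on the target space attached to a form `F` of degree `d`. For
linear `s`, `t` and `h` of degree `d - 2`, the quadric `lam (s²h) lam (t²h) - lam (sth)²` has rank
at most three and vanishes on the image, since `(s²h)(t²h) = (sth)²`. Let `Q` be an ideal containing
all of these. It suffices that `Q` contains the ideal of the image.

Modulo `Q`, polarization gives linear relations between the products `lam M * lam M'` of monomials
with a fixed total product. In characteristic three they force the exchange relations: a variable of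
`M` may be swapped with one of `M'` (`exchange_of_cubic`, then `exchange_list` by induction on `d`).
Hence a product of values of `lam` depends only on the total monomial, and `lam` extends to a
multiplicative `Ψ` on forms of degree divisible by `d` (`exists_multiplicative_extension`). `Ψ`
composed with the substitution `aeval f` is reduction modulo `Q`, and `Ψ` kills the ideal of the
variety because that ideal is generated in degrees at most `d`. So an equation of the image is zero
modulo `Q` (`comap_aeval_le_of_mem`).

Rank two is not enough: such a quadric is a product of linear forms, hence zero in a prime ideal
without linear forms, while the ideal of the image is nonzero. -/

/-! ### Polarization in characteristic three and the cubic case. -/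

section Exchange

variable {S A : Type*} [CommRing S] [CommRing A]

/-- The full polarization of `lam (s² h) lam (t² h) = lam (s t h)²` in characteristic three. -/
theorem sum_splittings_eq_zero (h3 : (3 : A) = 0) (lam : S →+ A) (V U : AddSubmonoid S)
    (H : ∀ s ∈ V, ∀ t ∈ V, ∀ h ∈ U,
      lam (s * s * h) * lam (t * t * h) = lam (s * t * h) * lam (s * t * h))
    {p q u v h k : S} (hp : p ∈ V) (hq : q ∈ V) (hu : u ∈ V) (hv : v ∈ V) (hh : h ∈ U)
    (hk : k ∈ U) :
    lam (p * q * h) * lam (u * v * k) + lam (p * q * k) * lam (u * v * h)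
      + lam (p * u * h) * lam (q * v * k) + lam (p * u * k) * lam (q * v * h)
      + lam (p * v * h) * lam (q * u * k) + lam (p * v * k) * lam (q * u * h) = 0 := by
  have H1 : ∀ p ∈ V, ∀ q ∈ V, ∀ t ∈ V, ∀ h ∈ U,
      2 * (lam (p * q * h) * lam (t * t * h)) = 2 * (lam (p * t * h) * lam (q * t * h)) := by
    intro p hp q hq t ht h hh
    have e := H _ (V.add_mem hp hq) t ht h hh
    have e1 := H p hp t ht h hh
    have e2 := H q hq t ht h hh
    rw [show (p + q) * (p + q) * h = p * p * h + (p * q * h + p * q * h) + q * q * h by ring,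
      show (p + q) * t * h = p * t * h + q * t * h by ring] at e
    simp only [map_add] at e
    linear_combination e - e1 - e2
  -- Polarizing in `t` gives the three pairings of `p, q, u, v` with coefficients 4, -2, -2, all
  -- equal to 1 modulo 3.
  have H2 : ∀ h ∈ U, lam (p * q * h) * lam (u * v * h) + lam (p * u * h) * lam (q * v * h)
      + lam (p * v * h) * lam (q * u * h) = 0 := by
    intro h hh
    have e := H1 p hp q hq _ (V.add_mem hu hv) h hh
    have e1 := H1 p hp q hq u hu h hh
    have e2 := H1 p hp q hq v hv h hh
    rw [show (u + v) * (u + v) * h = u * u * h + (u * v * h + u * v * h) + v * v * h by ring,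
      show p * (u + v) * h = p * u * h + p * v * h by ring,
      show q * (u + v) * h = q * u * h + q * v * h by ring] at e
    simp only [map_add] at e
    linear_combination e - e1 - e2 - (lam (p * q * h) * lam (u * v * h)
      - lam (p * u * h) * lam (q * v * h) - lam (p * v * h) * lam (q * u * h)) * h3
  have e := H2 _ (U.add_mem hh hk)
  have e1 := H2 h hh
  have e2 := H2 k hk
  simp only [mul_add, map_add] at e
  linear_combination e - e1 - e2

/-- Six factors split into two triples in ten ways. For each pair of factors,
`sum_splittings_eq_zero` says that the six splittings separating the pair sum to zero. Fix a
splitting `σ` and add these relations over the nine pairs it separates: `σ` occurs nine times and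
every other splitting five times, so `4σ + 5N = 0` with `N` the sum of all ten. Modulo 3 this reads
`σ = N`, so all splittings agree. -/
theorem exchange_of_cubic (h3 : (3 : A) = 0) (lam : S →+ A) (V : AddSubmonoid S)
    (H : ∀ s ∈ V, ∀ t ∈ V, ∀ h ∈ V,
      lam (s * s * h) * lam (t * t * h) = lam (s * t * h) * lam (s * t * h))
    {x y p q u v : S} (hx : x ∈ V) (hy : y ∈ V) (hp : p ∈ V) (hq : q ∈ V) (hu : u ∈ V)
    (hv : v ∈ V) :
    lam (x * (p * q)) * lam (y * (u * v)) = lam (y * (p * q)) * lam (x * (u * v)) := by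
  have T := @sum_splittings_eq_zero S A _ _ h3 lam V V H
  have key : ∀ {x y p q u v : S} {σ N : A}, x ∈ V → y ∈ V → p ∈ V → q ∈ V → u ∈ V → v ∈ V →
      σ = lam (x * (p * q)) * lam (y * (u * v)) →
      N = lam (x * (p * q)) * lam (y * (u * v)) + lam (x * (p * y)) * lam (q * (u * v))
        + lam (x * (p * u)) * lam (q * (y * v)) + lam (x * (p * v)) * lam (q * (y * u))
        + lam (x * (q * y)) * lam (p * (u * v)) + lam (x * (q * u)) * lam (p * (y * v))
        + lam (x * (q * v)) * lam (p * (y * u)) + lam (x * (y * u)) * lam (p * (q * v))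
        + lam (x * (y * v)) * lam (p * (q * u)) + lam (x * (u * v)) * lam (p * (q * y)) →
      σ = N := by
    intro x y p q u v σ N hx hy hp hq hu hv hσ hN
    have t1 := T hp hq hu hv hx hy
    have t2 := T hp hq hy hv hx hu
    have t3 := T hp hq hy hu hx hv
    have t4 := T hx hq hu hv hp hy
    have t5 := T hx hq hy hv hp hu
    have t6 := T hx hq hy hu hp hv
    have t7 := T hx hp hu hv hq hy
    have t8 := T hx hp hy hv hq hu
    have t9 := T hx hp hy hu hq hv
    simp only [mul_comm, mul_left_comm] at t1 t2 t3 t4 t5 t6 t7 t8 t9 hN hσ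
    linear_combination t1 + t2 + t3 + t4 + t5 + t6 + t7 + t8 + t9 - (σ + 2 * N) * h3
      + 4 * hσ + 5 * hN
  rw [key hx hy hp hq hu hv rfl rfl, key hy hx hp hq hu hv rfl rfl]
  simp only [mul_comm, mul_left_comm]
  ring

end Exchange

/-! ### Exchange relations in every degree at least three. -/

section Exchange

open MvPolynomial

variable {σ K A : Type*} [CommRing K] [CommRing A]

/-- Here `k + 3` is the degree. For a linear form `z`, the map `lam (z * ·)` satisfies the
hypothesis one degree lower, which gives the exchange when both monomials share the factor `z`;
polarizing in `z` removes the common factor. -/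
theorem exchange_list (h3 : (3 : A) = 0) (k : ℕ) (lam : MvPolynomial σ K →+ A)
    (H : ∀ s t h : MvPolynomial σ K, s.IsHomogeneous 1 → t.IsHomogeneous 1 →
      h.IsHomogeneous (k + 1) →
      lam (s * s * h) * lam (t * t * h) = lam (s * t * h) * lam (s * t * h))
    (i j : σ) (a b : List σ) (ha : a.length = k + 2) (hb : b.length = k + 2) :
    lam (X i * (a.map X).prod) * lam (X j * (b.map X).prod) =
      lam (X j * (a.map X).prod) * lam (X i * (b.map X).prod) := by
  induction k generalizing lam a b with
  | zero =>
    obtain ⟨p, q, rfl⟩ := List.length_eq_two.1 ha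
    obtain ⟨u, v, rfl⟩ := List.length_eq_two.1 hb
    simp only [List.map_cons, List.map_nil, List.prod_cons, List.prod_nil, mul_one]
    have hX : ∀ l : σ, X l ∈ (homogeneousSubmodule σ K 1).toAddSubmonoid :=
      fun l => isHomogeneous_X K l
    exact exchange_of_cubic h3 lam (homogeneousSubmodule σ K 1).toAddSubmonoid
      (fun s hs t ht h hh => H s t h hs ht hh) (hX i) (hX j) (hX p) (hX q) (hX u) (hX v)
  | succ k ih =>
    have hz : ∀ z : MvPolynomial σ K, z.IsHomogeneous 1 → ∀ a b : List σ, a.length = k + 2 →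
        b.length = k + 2 →
        lam (X i * (z * (a.map X).prod)) * lam (X j * (z * (b.map X).prod)) =
          lam (X j * (z * (a.map X).prod)) * lam (X i * (z * (b.map X).prod)) := by
      intro z hz a b ha hb
      have := ih (lam.comp (AddMonoidHom.mulLeft z)) (fun s t h hs ht hh => by
        have := H s t (z * h) hs ht (by
          rw [show k + 1 + 1 = 1 + (k + 1) by ring]; exact hz.mul hh)
        simpa [mul_comm, mul_left_comm, mul_assoc] using this) a b ha hb
      simpa [mul_comm, mul_left_comm, mul_assoc] using this
    have hzz : ∀ z w : σ, ∀ a b : List σ, a.length = k + 2 → b.length = k + 2 →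
        lam (X i * (X z * (a.map X).prod)) * lam (X j * (X w * (b.map X).prod)) +
          lam (X i * (X w * (a.map X).prod)) * lam (X j * (X z * (b.map X).prod)) =
        lam (X j * (X z * (a.map X).prod)) * lam (X i * (X w * (b.map X).prod)) +
          lam (X j * (X w * (a.map X).prod)) * lam (X i * (X z * (b.map X).prod)) := by
      intro z w a b ha hb
      have e := hz (X z + X w) ((isHomogeneous_X K z).add (isHomogeneous_X K w)) a b ha hb
      have e1 := hz (X z) (isHomogeneous_X K z) a b ha hb
      have e2 := hz (X w) (isHomogeneous_X K w) a b ha hb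
      simp only [add_mul, mul_add, map_add] at e
      linear_combination e - e1 - e2
    obtain ⟨z, a, rfl⟩ := List.exists_cons_of_length_eq_add_one ha
    obtain ⟨z', b, rfl⟩ := List.exists_cons_of_length_eq_add_one hb
    simp only [List.length_cons, Nat.add_right_cancel_iff] at ha hb
    obtain ⟨z'', b, rfl⟩ := List.exists_cons_of_length_eq_add_one hb
    simp only [List.length_cons, Nat.add_right_cancel_iff] at hb
    -- Let `D z` be the defect of the exchange when `z` is placed with `a` and the other two of `z,
    -- z', z''` with `b`. The relations say that any two of `D z`, `D z'`, `D z''` sum to zero, so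
    -- `2 * D z = 0`, and `3 = 0` gives `D z = 0`.
    have e1 := hzz z z' a (z'' :: b) ha (by simp [hb])
    have e2 := hzz z' z'' a (z :: b) ha (by simp [hb])
    have e3 := hzz z'' z a (z' :: b) ha (by simp [hb])
    simp only [List.map_cons, List.prod_cons, mul_left_comm (X z' : MvPolynomial σ K) (X z),
      mul_left_comm (X z'' : MvPolynomial σ K) (X z),
      mul_left_comm (X z'' : MvPolynomial σ K) (X z')] at e1 e2 e3 ⊢
    linear_combination -e1 + e2 - e3 + (lam (X i * (X z * (List.map X a).prod)) *
      lam (X j * (X z' * (X z'' * (List.map X b).prod))) -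
      lam (X j * (X z * (List.map X a).prod)) *
      lam (X i * (X z' * (X z'' * (List.map X b).prod)))) * h3

theorem exchange_monomial (h3 : (3 : A) = 0) (d : ℕ) (hd : 3 ≤ d) (lam : MvPolynomial σ K →+ A)
    (H : ∀ s t h : MvPolynomial σ K, s.IsHomogeneous 1 → t.IsHomogeneous 1 →
      h.IsHomogeneous (d - 2) →
      lam (s * s * h) * lam (t * t * h) = lam (s * t * h) * lam (s * t * h))
    (i j : σ) (a b : σ →₀ ℕ) (ha : a.degree + 1 = d) (hb : b.degree + 1 = d) :
    lam (monomial (a + Finsupp.single i 1) 1) * lam (monomial (b + Finsupp.single j 1) 1) =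
      lam (monomial (a + Finsupp.single j 1) 1) * lam (monomial (b + Finsupp.single i 1) 1) := by
  classical
  obtain ⟨k, rfl⟩ := Nat.exists_eq_add_of_le' hd
  have hmon : ∀ (c : σ →₀ ℕ) (l : σ), (monomial (c + Finsupp.single l 1) 1 : MvPolynomial σ K) =
      X l * (c.toMultiset.toList.map X).prod := by
    intro c l
    rw [← Multiset.prod_coe, ← Multiset.map_coe, Multiset.coe_toList, add_comm,
      monomial_single_add, pow_one, Finsupp.toMultiset_map, Finsupp.prod_toMultiset,
      Finsupp.prod_mapDomain_index (by simp) (fun _ _ _ => pow_add _ _ _), monomial_eq, C_1,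
      one_mul]
  have hlen : ∀ c : σ →₀ ℕ, c.toMultiset.toList.length = c.degree := by
    intro c
    rw [Multiset.length_toList, Finsupp.card_toMultiset]
    rfl
  simp only [hmon]
  exact exchange_list h3 k lam H i j _ _ (by rw [hlen]; omega) (by rw [hlen]; omega)

end Exchange

/-! ### Independence of the factorization of a monomial into factors of degree `d`. -/

section Factorization

variable {σ A : Type*} [Fintype σ] [CommMonoid A] {d : ℕ} {μ : (σ →₀ ℕ) → A}

theorem exists_multiset_sum_eq {τ : Type*} (d j : ℕ) (α : τ →₀ ℕ) (h : α.degree = d * j) :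
    ∃ s : Multiset (τ →₀ ℕ), (∀ m ∈ s, m.degree = d) ∧ s.sum = α := by
  induction j generalizing α with
  | zero => exact ⟨0, by simp, ((Finsupp.degree_eq_zero_iff α).1 (by simpa using h)).symm⟩
  | succ j ih =>
    obtain ⟨g, hg, hgd⟩ := α.exists_le_degree_eq d (by rw [h]; exact Nat.le_mul_of_pos_right _ (by simp))
    obtain ⟨f, rfl⟩ := le_iff_exists_add.mp hg
    obtain ⟨s, hs, rfl⟩ := ih f (by rw [map_add, hgd, mul_add] at h; omega)
    exact ⟨g ::ₘ s, by simpa [hgd] using hs, by simp⟩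

theorem degree_multiset_sum {τ : Type*} (s : Multiset (τ →₀ ℕ)) (hs : ∀ m ∈ s, m.degree = d) :
    s.sum.degree = d * s.card := by
  induction s using Multiset.induction_on with
  | empty => simp
  | cons a s ih =>
    rw [Multiset.sum_cons, map_add, ih fun m hm => hs m (Multiset.mem_cons_of_mem hm),
      hs a (Multiset.mem_cons_self a s), Multiset.card_cons]
    ring

/-- A factorization of a multiple of `n` may be changed by exchanges until `n` is a factor. -/
theorem exists_cons_prod_eq
    (hμ : ∀ (i j : σ) (a b : σ →₀ ℕ), a.degree + 1 = d → b.degree + 1 = d →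
      μ (a + Finsupp.single i 1) * μ (b + Finsupp.single j 1) =
        μ (a + Finsupp.single j 1) * μ (b + Finsupp.single i 1))
    (n : σ →₀ ℕ) (hn : n.degree = d) (k : ℕ) (m : σ →₀ ℕ) (s : Multiset (σ →₀ ℕ))
    (hk : (m - n).degree = k) (hm : m.degree = d) (hs : ∀ m ∈ s, m.degree = d)
    (hle : n ≤ m + s.sum) :
    ∃ s' : Multiset (σ →₀ ℕ), (∀ m ∈ s', m.degree = d) ∧ n + s'.sum = m + s.sum ∧
      μ n * (s'.map μ).prod = μ m * (s.map μ).prod := by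
  classical
  induction k generalizing m s with
  | zero =>
    have h : m ≤ n := by
      rw [Finsupp.degree_eq_zero_iff, tsub_eq_zero_iff_le] at hk
      exact hk
    obtain ⟨c, rfl⟩ := le_iff_exists_add.mp h
    rw [map_add, hm, add_eq_left, Finsupp.degree_eq_zero_iff] at hn
    subst hn
    exact ⟨s, hs, by simp, by simp⟩
  | succ k ih =>
    -- As `m` and `n` have equal degree, `m` exceeds `n` at some `j` and falls short at some `i`;
    -- the missing `i` occurs in another factor since `n` divides the total product. Swapping `j`
    -- for `i` lowers the degree of the truncated difference `m - n` by one.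
    obtain ⟨j, hj⟩ : ∃ j, n j < m j := by
      by_contra! h
      rw [tsub_eq_zero_iff_le.2 h] at hk
      simp at hk
    obtain ⟨i, hi⟩ : ∃ i, m i < n i := by
      by_contra! h
      rw [Finsupp.degree_eq_sum] at hn hm
      exact absurd (Finset.sum_lt_sum (fun i _ => h i) ⟨j, Finset.mem_univ j, hj⟩) (by omega)
    have hij : i ≠ j := by rintro rfl; omega
    obtain ⟨m', hm's, hm'⟩ : ∃ m' ∈ s, 0 < m' i := by
      by_contra! h
      have h0 : s.sum i = 0 := by
        have : s.sum i = (s.map fun f => f i).sum := by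
          simpa using map_multiset_sum (Finsupp.applyAddHom i) s
        rw [this]
        exact Multiset.sum_eq_zero (by simpa using h)
      have := hle i
      rw [Finsupp.add_apply, h0] at this
      omega
    obtain ⟨s, rfl⟩ := Multiset.exists_cons_of_mem hm's
    obtain ⟨a, rfl⟩ : ∃ a, m = a + Finsupp.single j 1 :=
      ⟨m - Finsupp.single j 1, (tsub_add_cancel_of_le (by simp; omega)).symm⟩
    obtain ⟨b, rfl⟩ : ∃ b, m' = b + Finsupp.single i 1 :=
      ⟨m' - Finsupp.single i 1, (tsub_add_cancel_of_le (by simp; omega)).symm⟩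
    have ha : a.degree + 1 = d := by simpa using hm
    have hb : b.degree + 1 = d := by simpa using hs _ (Multiset.mem_cons_self _ _)
    have hsum : (a + Finsupp.single i 1) + ((b + Finsupp.single j 1) ::ₘ s).sum =
        (a + Finsupp.single j 1) + ((b + Finsupp.single i 1) ::ₘ s).sum := by
      simp only [Multiset.sum_cons]
      abel
    obtain ⟨s', h1, h2, h3⟩ := ih (a + Finsupp.single i 1) ((b + Finsupp.single j 1) ::ₘ s) (by
        have e : a + Finsupp.single j 1 - n = (a + Finsupp.single i 1 - n) + Finsupp.single j 1 := by
          ext l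
          simp only [Finsupp.add_apply, Finsupp.tsub_apply, Finsupp.single_apply] at hi hj ⊢
          by_cases h1 : i = l
          · subst h1
            simp only [hij.symm, if_true, if_false] at hi hj ⊢
            omega
          · by_cases h2 : j = l
            · subst h2
              simp only [hij, if_true, if_false] at hi hj ⊢
              omega
            · simp [h1, h2]
        rw [e, map_add, Finsupp.degree_single] at hk
        omega) (by simpa using ha) (by
        intro c hc
        rcases Multiset.mem_cons.1 hc with rfl | hc
        · simpa using hb
        · exact hs c (Multiset.mem_cons_of_mem hc)) (hsum ▸ hle)
    refine ⟨s', h1, h2.trans hsum, h3.trans ?_⟩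
    simp only [Multiset.map_cons, Multiset.prod_cons, ← mul_assoc]
    rw [hμ i j a b ha hb]

theorem prod_map_eq_of_sum_eq (hd : 0 < d)
    (hμ : ∀ (i j : σ) (a b : σ →₀ ℕ), a.degree + 1 = d → b.degree + 1 = d →
      μ (a + Finsupp.single i 1) * μ (b + Finsupp.single j 1) =
        μ (a + Finsupp.single j 1) * μ (b + Finsupp.single i 1))
    (s t : Multiset (σ →₀ ℕ)) (hs : ∀ m ∈ s, m.degree = d) (ht : ∀ m ∈ t, m.degree = d)
    (h : s.sum = t.sum) : (s.map μ).prod = (t.map μ).prod := by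
  induction t using Multiset.induction_on generalizing s with
  | empty =>
    have h1 := degree_multiset_sum s hs
    rw [h] at h1
    have : s = 0 := by simpa [hd.ne'] using h1
    rw [this]
  | cons n t ih =>
    have hn := ht n (Multiset.mem_cons_self n t)
    have h1 := degree_multiset_sum s hs
    rw [h, degree_multiset_sum _ ht, Multiset.card_cons] at h1
    obtain ⟨m, hm⟩ : ∃ m, m ∈ s := by
      refine Multiset.exists_mem_of_ne_zero ?_
      rintro rfl
      simp [hd.ne'] at h1
    obtain ⟨s, rfl⟩ := Multiset.exists_cons_of_mem hm
    rw [Multiset.sum_cons, Multiset.sum_cons] at h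
    obtain ⟨s', h2, h3, h4⟩ := exists_cons_prod_eq hμ n hn _ m s rfl
      (hs m hm) (fun c hc => hs c (Multiset.mem_cons_of_mem hc)) (h ▸ le_self_add)
    rw [Multiset.map_cons, Multiset.prod_cons, Multiset.map_cons, Multiset.prod_cons, ← h4,
      ih s' h2 (fun c hc => ht c (Multiset.mem_cons_of_mem hc))
        (add_left_cancel (h3.trans h))]

end Factorization

/-! ### Multiplicative extension of `lam`. -/

section Extension

open MvPolynomial

variable {σ K A : Type*} [Fintype σ] [CommRing K] [CommRing A] [Algebra K A]

/-- A linear map on forms of degree `d` whose products satisfy the exchange relations extends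
multiplicatively to all forms of degree divisible by `d`. -/
theorem exists_multiplicative_extension {d : ℕ} (hd : 0 < d) (lam : MvPolynomial σ K →ₗ[K] A)
    (hμ : ∀ (i j : σ) (a b : σ →₀ ℕ), a.degree + 1 = d → b.degree + 1 = d →
      lam (monomial (a + Finsupp.single i 1) 1) * lam (monomial (b + Finsupp.single j 1) 1) =
        lam (monomial (a + Finsupp.single j 1) 1) * lam (monomial (b + Finsupp.single i 1) 1)) :
    ∃ Ψ : MvPolynomial σ K →ₗ[K] A, Ψ 1 = 1 ∧
      (∀ F G, F.IsHomogeneous d → Ψ (F * G) = lam F * Ψ G) ∧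
      ∀ e F, F.IsHomogeneous e → ¬ d ∣ e → Ψ F = 0 := by
  classical
  let μ : (σ →₀ ℕ) → A := fun α => lam (monomial α 1)
  let P : (σ →₀ ℕ) → Multiset (σ →₀ ℕ) → Prop := fun α s => (∀ m ∈ s, m.degree = d) ∧ s.sum = α
  -- A factorization exists exactly when `d` divides the degree; the default 0 is taken in the
  -- remaining degrees.
  let ψ : (σ →₀ ℕ) → A := fun α => if h : ∃ s, P α s then (h.choose.map μ).prod else 0
  have hψ : ∀ s : Multiset (σ →₀ ℕ), (∀ m ∈ s, m.degree = d) → ψ s.sum = (s.map μ).prod := by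
    intro s hs
    have h : ∃ t, P s.sum t := ⟨s, hs, rfl⟩
    simp only [ψ, dif_pos h]
    exact prod_map_eq_of_sum_eq hd hμ _ _ h.choose_spec.1 hs h.choose_spec.2
  have hψ0 : ∀ α : σ →₀ ℕ, ¬ d ∣ α.degree → ψ α = 0 := by
    intro α hα
    refine dif_neg ?_
    rintro ⟨s, hs, rfl⟩
    exact hα (degree_multiset_sum s hs ▸ dvd_mul_right _ _)
  let Ψ : MvPolynomial σ K →ₗ[K] A := (basisMonomials σ K).constr K ψ
  have hΨ : ∀ α c, Ψ (monomial α c) = c • ψ α := by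
    intro α c
    have h1 : monomial α c = c • basisMonomials σ K α := by
      simp [coe_basisMonomials, smul_monomial]
    rw [h1, map_smul, Module.Basis.constr_basis]
  have hsum : ∀ F : MvPolynomial σ K, Ψ F = ∑ α ∈ F.support, coeff α F • ψ α := by
    intro F
    conv_lhs => rw [F.as_sum, map_sum]
    exact Finset.sum_congr rfl fun α _ => hΨ _ _
  refine ⟨Ψ, ?_, ?_, ?_⟩
  · have := hψ 0 (by simp)
    rw [show (1 : MvPolynomial σ K) = monomial 0 1 from rfl, hΨ, one_smul]
    simpa using this
  · have key : ∀ α : σ →₀ ℕ, α.degree = d → ∀ G, Ψ (monomial α 1 * G) = lam (monomial α 1) * Ψ G := by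
      intro α hα G
      induction G using MvPolynomial.induction_on' with
      | add p q hp hq => rw [mul_add, map_add, hp, hq, map_add, mul_add]
      | monomial β c =>
        rw [monomial_mul, one_mul, hΨ, hΨ, mul_smul_comm]
        congr 1
        by_cases h : d ∣ β.degree
        · obtain ⟨j, hj⟩ := h
          obtain ⟨s, hs, rfl⟩ := exists_multiset_sum_eq d j β hj
          rw [hψ s hs, ← Multiset.sum_cons, hψ (α ::ₘ s) (by simpa [hα] using hs),
            Multiset.map_cons, Multiset.prod_cons]
        · rw [hψ0 β h, hψ0 (α + β) (by rwa [map_add, hα, Nat.dvd_add_right (dvd_refl d)]), mul_zero]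
    intro F G hF
    conv_lhs => rw [F.as_sum]
    conv_rhs => rw [F.as_sum]
    rw [Finset.sum_mul, map_sum, map_sum, Finset.sum_mul]
    refine Finset.sum_congr rfl fun α hα => ?_
    have h1 : monomial α (coeff α F) = coeff α F • (monomial α 1 : MvPolynomial σ K) := by
      simp [smul_monomial]
    have h2 : α.degree = d := by
      rw [Finsupp.degree_eq_weight_one]
      exact hF (mem_support_iff.1 hα)
    rw [h1, smul_mul_assoc, map_smul, map_smul, key α h2, smul_mul_assoc]
  · intro e F hF he
    rw [hsum]
    refine Finset.sum_eq_zero fun α hα => ?_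
    rw [hψ0 α, smul_zero]
    rw [Finsupp.degree_eq_weight_one]
    exact (hF (mem_support_iff.1 hα)).symm ▸ he

end Extension

/-! ### Equations of the image lie in `Q`. -/

section Comap

open MvPolynomial

variable {σ ι K : Type*} [Fintype σ] [CommRing K]

theorem comap_aeval_le_of_mem {d m : ℕ} (h3 : (3 : K) = 0) (hd : 3 ≤ d) (hmd : m ≤ d)
    (f : ι → MvPolynomial σ K) (hf : ∀ i, (f i).IsHomogeneous d)
    (lam : MvPolynomial σ K →ₗ[K] MvPolynomial ι K) (hlam : ∀ i, lam (f i) = X i)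
    (Q : Ideal (MvPolynomial ι K))
    (hQ : ∀ s t h : MvPolynomial σ K, s.IsHomogeneous 1 → t.IsHomogeneous 1 →
      h.IsHomogeneous (d - 2) →
      lam (s * s * h) * lam (t * t * h) - lam (s * t * h) * lam (s * t * h) ∈ Q)
    (I : Ideal (MvPolynomial σ K)) (hI : I = Ideal.span {F | F ∈ I ∧ ∃ e ≤ m, F.IsHomogeneous e})
    (hI0 : ∀ c : K, C c ∈ I → c = 0) (hlamI : ∀ F ∈ I, F.IsHomogeneous d → lam F = 0) :
    I.comap (aeval f) ≤ Q := by
  have h3' : (3 : MvPolynomial ι K ⧸ Q) = 0 := by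
    have := congrArg (algebraMap K (MvPolynomial ι K ⧸ Q)) h3
    rwa [map_ofNat, map_zero] at this
  let mk := (Ideal.Quotient.mkₐ K Q).toLinearMap
  obtain ⟨Ψ, h1, hmul, h0⟩ := exists_multiplicative_extension (by omega : 0 < d) (mk ∘ₗ lam)
    (exchange_monomial h3' d hd (mk ∘ₗ lam).toAddMonoidHom (by
      intro s t h hs ht hh
      exact (Ideal.Quotient.mk_eq_mk_iff_sub_mem _ _).2 (hQ s t h hs ht hh)))
  have hΨ : ∀ P : MvPolynomial ι K, Ψ (aeval f P) = mk P := by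
    intro P
    induction P using MvPolynomial.induction_on with
    | C c =>
      rw [algHom_C, Algebra.algebraMap_eq_smul_one, map_smul, h1, C_eq_smul_one, map_smul]
      rfl
    | add p q hp hq => rw [map_add, map_add, hp, hq, map_add]
    | mul_X p i hp =>
      rw [map_mul, aeval_X, mul_comm, hmul _ _ (hf i), hp, LinearMap.comp_apply, hlam, mul_comm p]
      exact (map_mul (Ideal.Quotient.mkₐ K Q) _ _).symm
  have hΨI : ∀ F ∈ I, ∀ G, Ψ (G * F) = 0 := by
    intro F hF
    rw [hI] at hF
    induction hF using Submodule.span_induction with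
    | zero => simp
    | add p q _ _ hp hq => intro G; rw [mul_add, map_add, hp, hq, add_zero]
    | smul H p _ hp => intro G; rw [smul_eq_mul, ← mul_assoc, hp]
    | mem F hF =>
      obtain ⟨hFI, e, he, hFe⟩ := hF
      intro G
      induction G using MvPolynomial.induction_on' with
      | add p q hp hq => rw [add_mul, map_add, hp, hq, add_zero]
      | monomial β c =>
        -- If `β` has room, part of it raises `F` to a form of degree exactly `d` in `I`, which
        -- `lam` kills. Otherwise the product has degree less than `d`: either `Ψ` vanishes there,
        -- or the degree is 0 and `F` is a constant in `I`, hence zero.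
        by_cases hβ : d - e ≤ β.degree
        · obtain ⟨γ, hγ, hγd⟩ := β.exists_le_degree_eq _ hβ
          obtain ⟨δ, rfl⟩ := le_iff_exists_add.mp hγ
          have hhom : (monomial γ 1 * F).IsHomogeneous d := by
            have := (isHomogeneous_monomial (1 : K) hγd).mul hFe
            rwa [Nat.sub_add_cancel (he.trans hmd)] at this
          rw [show monomial (γ + δ) c * F = (monomial γ 1 * F) * monomial δ c by
            rw [mul_right_comm, monomial_mul, one_mul], hmul _ _ hhom, LinearMap.comp_apply,
            hlamI _ (I.mul_mem_left _ hFI) hhom, map_zero, zero_mul]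
        · rcases Nat.eq_zero_or_pos (β.degree + e) with h | h
          · obtain rfl : e = 0 := by omega
            have hFC : F = C (coeff 0 F) := by
              rw [← homogeneousComponent_zero, homogeneousComponent_of_mem hFe, if_pos rfl]
            have hc := hI0 _ (hFC ▸ hFI)
            rw [hFC, hc, C_0, mul_zero, map_zero]
          · refine h0 _ _ ((isHomogeneous_monomial c rfl).mul hFe) fun h' => ?_
            have := Nat.le_of_dvd h h'
            omega
  intro P hP
  have := hΨI _ hP 1
  rw [one_mul, hΨ] at this
  exact Ideal.Quotient.eq_zero_iff_mem.1 this

end Comap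

/-! ### Quadrics of rank at most three and at most two. -/

section Quadrics

open MvPolynomial

variable {K ι : Type*} [Field K] [Fintype ι] {N : ℕ}

/-- The linear form with given coefficients. -/
noncomputable def linearForm (K ι : Type*) [Field K] [Fintype ι] :
    (ι → K) →ₗ[K] MvPolynomial ι K :=
  Fintype.linearCombination K X

theorem linearForm_apply (a : ι → K) : linearForm K ι a = ∑ i, C (a i) * X i := by
  simp [linearForm, Fintype.linearCombination_apply, smul_eq_C_mul]

theorem eval_linearForm (a x : ι → K) : eval x (linearForm K ι a) = ∑ i, a i * x i := by
  simp [linearForm_apply]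

theorem linearForm_mul (a b : ι → K) :
    linearForm K ι a * linearForm K ι b = ∑ i, ∑ j, C (a i * b j) * (X i * X j) := by
  rw [linearForm_apply, linearForm_apply, Finset.sum_mul_sum]
  refine Finset.sum_congr rfl fun i _ => Finset.sum_congr rfl fun j _ => ?_
  rw [C_mul]
  ring

theorem exists_isQuadricOfRank_le_three (h2 : (2 : K) ≠ 0) (a b c : Fin (N + 1) → K) :
    ∃ ρ ≤ 3, IsQuadricOfRank (linearForm K _ a * linearForm K _ b -
      linearForm K _ c * linearForm K _ c) ρ := by
  -- The symmetric matrix of `ab - c²` factors through a space of dimension three; the halves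
  -- symmetrize `ab`.
  let U : Matrix (Fin (N + 1)) (Fin 3) K := Matrix.of fun i => ![a i / 2, b i / 2, -c i]
  let V : Matrix (Fin 3) (Fin (N + 1)) K := Matrix.of ![b, a, c]
  have hUV : ∀ i j, (U * V) i j = a i / 2 * b j + b i / 2 * a j - c i * c j := by
    intro i j
    simp [U, V, Matrix.mul_apply, Fin.sum_univ_three]
    ring
  refine ⟨(U * V).rank, (Matrix.rank_mul_le_left U V).trans (Matrix.rank_le_width U), U * V, ?_,
    rfl, ?_⟩
  · ext i j
    rw [Matrix.transpose_apply, hUV, hUV]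
    ring
  · have h : linearForm K _ a * linearForm K _ b = C (1 / 2) * (linearForm K _ a * linearForm K _ b)
        + C (1 / 2) * (linearForm K _ b * linearForm K _ a) := by
      have := NeZero.mk h2
      rw [mul_comm (linearForm K _ b), ← add_mul, ← C_add, add_halves, C_1, one_mul]
    rw [h]
    simp only [linearForm_mul, Finset.mul_sum, ← Finset.sum_add_distrib, ← Finset.sum_sub_distrib]
    refine Finset.sum_congr rfl fun i _ => Finset.sum_congr rfl fun j _ => ?_
    simp only [hUV, C_sub, C_add, div_eq_mul_inv, C_mul, C_1]
    ring

/-- Writing the columns of `A` in a basis of its column space gives `A = A U P`; transposing,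
symmetry of `A` gives `A U = Pᵀ (Uᵀ A U)`. -/
theorem exists_congruence_of_isSymm {A : Matrix ι ι K} (hA : A.IsSymm) {ρ : ℕ} (hρ : A.rank = ρ) :
    ∃ (P : Matrix (Fin ρ) ι K) (M : Matrix (Fin ρ) (Fin ρ) K), A = P.transpose * M * P := by
  classical
  let B : Module.Basis (Fin ρ) K (LinearMap.range A.mulVecLin) :=
    Module.finBasisOfFinrankEq K _ hρ
  choose u hu using fun k => (B k).2
  let P : Matrix (Fin ρ) ι K := Matrix.of fun k i =>
    B.repr ⟨A.mulVecLin (Pi.single i 1), LinearMap.mem_range_self _ _⟩ k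
  let U : Matrix ι (Fin ρ) K := Matrix.of fun i k => u k i
  have hAP : A = A * U * P := by
    ext j i
    have h1 : (∑ k, P k i • B k : LinearMap.range A.mulVecLin).1 j = A j i := by
      refine (congrArg (fun w : LinearMap.range A.mulVecLin => w.1 j) (B.sum_repr _)).trans ?_
      simp
    have h2 : ∀ k, (A * U) j k = (B k).1 j := by
      intro k
      rw [← hu]
      rfl
    rw [Matrix.mul_apply, Finset.sum_congr rfl fun k _ => congrArg (· * P k i) (h2 k)]
    rw [← h1, Submodule.coe_sum, Finset.sum_apply]
    exact Finset.sum_congr rfl fun k _ => mul_comm _ _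
  have hAU : A * U = P.transpose * (U.transpose * A * U) := by
    conv_lhs => rw [← hA.eq, hAP]
    simp only [Matrix.transpose_mul, hA.eq, Matrix.mul_assoc]
  exact ⟨P, U.transpose * A * U, by rw [← hAU]; exact hAP⟩

theorem binary_quadratic_factor [IsAlgClosed K] (α β γ : K) :
    ∃ a b c d : K, a * c = α ∧ a * d + b * c = β ∧ b * d = γ := by
  by_cases hα : α = 0
  · exact ⟨0, 1, β, γ, by simp [hα], by simp, by simp⟩
  · obtain ⟨x, hx⟩ := IsAlgClosed.exists_root
      (Polynomial.C α * Polynomial.X ^ 2 + Polynomial.C β * Polynomial.X + Polynomial.C γ)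
      (by rw [Polynomial.degree_quadratic hα]; decide)
    simp only [Polynomial.IsRoot, Polynomial.eval_add, Polynomial.eval_mul, Polynomial.eval_C,
      Polynomial.eval_pow, Polynomial.eval_X] at hx
    exact ⟨1, -x, α, β + α * x, by simp, by ring, by linear_combination -hx⟩

/-- Over an algebraically closed field a quadric of rank at most two is a product of two linear
forms. -/
theorem IsQuadricOfRank.eq_mul [IsAlgClosed K] {q : MvPolynomial (Fin (N + 1)) K} {ρ : ℕ}
    (hq : IsQuadricOfRank q ρ) (hρ : ρ ≤ 2) :
    ∃ a b : Fin (N + 1) → K, q = linearForm K _ a * linearForm K _ b := by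
  obtain ⟨A, hA, hr, rfl⟩ := hq
  obtain ⟨P, M, hM⟩ := exists_congruence_of_isSymm hA hr
  have key : (∑ i, ∑ j, C (A i j) * (X i * X j) : MvPolynomial (Fin (N + 1)) K) =
      ∑ k, ∑ l, C (M k l) * (linearForm K _ (P k) * linearForm K _ (P l)) := by
    have hAij : ∀ i j, A i j = ∑ k, ∑ l, M k l * (P k i * P l j) := by
      intro i j
      rw [hM, Matrix.mul_assoc, Matrix.mul_apply]
      refine Finset.sum_congr rfl fun k _ => ?_
      rw [Matrix.mul_apply, Finset.mul_sum]
      refine Finset.sum_congr rfl fun l _ => ?_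
      rw [Matrix.transpose_apply]
      ring
    simp only [linearForm_mul, Finset.mul_sum, hAij, map_sum, Finset.sum_mul]
    rw [Finset.sum_congr rfl fun i _ => Finset.sum_comm, Finset.sum_comm]
    refine Finset.sum_congr rfl fun k _ => ?_
    rw [Finset.sum_congr rfl fun i _ => Finset.sum_comm, Finset.sum_comm]
    refine Finset.sum_congr rfl fun l _ => Finset.sum_congr rfl fun i _ =>
      Finset.sum_congr rfl fun j _ => ?_
    simp only [C_mul]
    ring
  rw [key]
  interval_cases ρ
  · exact ⟨0, 0, by simp⟩
  · exact ⟨M 0 0 • P 0, P 0, by simp [smul_eq_C_mul]; ring⟩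
  · obtain ⟨a, b, c, d, h1, h2, h3⟩ := binary_quadratic_factor (M 0 0) (M 0 1 + M 1 0) (M 1 1)
    refine ⟨a • P 0 + b • P 1, c • P 0 + d • P 1, ?_⟩
    have h2' := congrArg (C (σ := Fin (N + 1))) h2
    simp only [Fin.sum_univ_two, map_add, map_smul, smul_eq_C_mul, ← h1, ← h3, C_mul] at h2' ⊢
    linear_combination (-linearForm K _ (P 0) * linearForm K _ (P 1)) * h2'

end Quadrics

/-! ### The embedding by `|L^d|` and its rank index. -/

section Embedding

open MvPolynomial

variable {K : Type*} [Field K] {r : ℕ}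

theorem MvPolynomial.IsHomogeneous.eval_smul {σ : Type*} {F : MvPolynomial σ K} {e : ℕ}
    (hF : F.IsHomogeneous e) (t : K) (v : σ → K) :
    eval (t • v) F = t ^ e * eval v F := by
  rw [eval_eq, eval_eq, Finset.mul_sum]
  refine Finset.sum_congr rfl fun α hα => ?_
  have h : α.degree = e := by
    rw [Finsupp.degree_eq_weight_one]
    exact hF (mem_support_iff.1 hα)
  simp only [Pi.smul_apply, smul_eq_mul, mul_pow, Finset.prod_mul_distrib]
  rw [Finset.prod_pow_eq_pow_sum, ← Finsupp.degree_apply, h]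
  ring

theorem smul_mem_affineCone {X : Set (PSpace K r)} {v : Fin (r + 1) → K} (hv : v ∈ affineCone X)
    {t : K} (ht : t ≠ 0) : t • v ∈ affineCone X := by
  obtain ⟨h, hX⟩ := hv
  refine ⟨smul_ne_zero ht h, ?_⟩
  rwa [(Projectivization.mk_eq_mk_iff' K _ _ (smul_ne_zero ht h) h).2 ⟨t, rfl⟩]

theorem mem_homogeneousIdeal_iff {X : Set (PSpace K r)} {F : MvPolynomial (Fin (r + 1)) K} :
    F ∈ homogeneousIdeal X ↔ ∀ v ∈ affineCone X, eval v F = 0 := Iff.rfl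

/-- The ideal of the image of `X` under a map given by forms is the inverse image of the ideal
of `X`. -/
theorem homogeneousIdeal_imageBySections [IsAlgClosed K] {X : Set (PSpace K r)} {d N : ℕ}
    (hd : d ≠ 0) (s : Fin (N + 1) → sections X d) (f : Fin (N + 1) → MvPolynomial (Fin (r + 1)) K)
    (hf : ∀ i, (f i).IsHomogeneous d) (hfs : ∀ i (v : affineCone X), (s i).1 v = eval v.1 (f i))
    (hs : ∀ v : affineCone X, (fun i => (s i).1 v) ≠ 0) :
    homogeneousIdeal (imageBySections X s) = (homogeneousIdeal X).comap (aeval f) := by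
  have heval : ∀ (v : Fin (r + 1) → K) P, eval v (aeval f P) = eval (fun i => eval v (f i)) P := by
    intro v P
    induction P using MvPolynomial.induction_on with
    | C c => simp [algebraMap_eq]
    | add p q hp hq => rw [map_add, map_add, hp, hq, map_add]
    | mul_X p i hp => rw [map_mul, map_mul, hp, aeval_X, map_mul, eval_X]
  ext P
  rw [Ideal.mem_comap, mem_homogeneousIdeal_iff, mem_homogeneousIdeal_iff]
  constructor
  · intro h v hv
    rw [heval]
    refine h _ ⟨?_, ⟨v, hv⟩, ?_, ?_⟩
    · simpa only [hfs] using hs ⟨v, hv⟩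
    · exact hs _
    · simp only [hfs]
  · rintro h w ⟨hw, v, hv, hwv⟩
    obtain ⟨c, hc⟩ := (Projectivization.mk_eq_mk_iff' K _ _ hw hv).1 hwv
    -- A `d`-th root of the scalar moves it into the cone over `X`, since the `f i` have degree `d`.
    obtain ⟨t, rfl⟩ := IsAlgClosed.exists_pow_nat_eq c (Nat.pos_of_ne_zero hd)
    have ht : t ≠ 0 := by
      rintro rfl
      rw [zero_pow hd, zero_smul] at hc
      exact hw hc.symm
    have := h _ (smul_mem_affineCone v.2 ht)
    rw [heval] at this
    have hwt : w = fun i => eval (t • v.1) (f i) := by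
      rw [← hc]
      funext i
      rw [(hf i).eval_smul, Pi.smul_apply, hfs, smul_eq_mul]
    rwa [hwt]

theorem exists_eq_smul_of_forall_sum_eq_zero {ι : Type*} [Fintype ι] {a c : ι → K} (ha : a ≠ 0)
    (h : ∀ y : ι → K, ∑ i, a i * y i = 0 → ∑ i, c i * y i = 0) : ∃ k : K, c = k • a := by
  classical
  obtain ⟨i, hi⟩ := Function.ne_iff.1 ha
  rw [Pi.zero_apply] at hi
  refine ⟨c i / a i, ?_⟩
  ext j
  have := h (a i • Pi.single j 1 - a j • Pi.single i 1) (by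
    simp [mul_sub, Finset.sum_sub_distrib, Pi.single_apply, mul_comm])
  simp only [Pi.sub_apply, Pi.smul_apply, smul_eq_mul, mul_sub, Finset.sum_sub_distrib,
    Pi.single_apply, mul_ite, mul_one, mul_zero, Finset.sum_ite_eq', Finset.mem_univ,
    if_true] at this
  rw [Pi.smul_apply, smul_eq_mul]
  field_simp
  linear_combination this

/-- Common form of both claims: all that is needed of `Z` is primality of its ideal on forms,
absence of linear equations, normality in degree `d` and generators of degree at most `d`. -/
theorem hasRankIndex_three [IsAlgClosed K] (h3 : (3 : K) = 0) {Z : Set (PSpace K r)} (hr : r ≠ 0)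
    (hprime : ∀ (e e' : ℕ) (F G : MvPolynomial (Fin (r + 1)) K), F.IsHomogeneous e →
      G.IsHomogeneous e' → F * G ∈ homogeneousIdeal Z →
      F ∈ homogeneousIdeal Z ∨ G ∈ homogeneousIdeal Z)
    (hlin : ∀ F : MvPolynomial (Fin (r + 1)) K, F.IsHomogeneous 1 → F ∈ homogeneousIdeal Z → F = 0)
    {m d : ℕ} (hd : 3 ≤ d) (hmd : m ≤ d) (hnorm : IsNormalInDegree Z d)
    (hgen : IdealGeneratedInDegreeLE Z m) : HasRankIndex Z d 3 := by
  have h2 : (2 : K) ≠ 0 := by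
    intro h2
    exact one_ne_zero (α := K) (by linear_combination h3 - h2)
  have hX0 : (X 0 : MvPolynomial (Fin (r + 1)) K) ∉ homogeneousIdeal Z := fun h =>
    X_ne_zero 0 (hlin _ (isHomogeneous_X K 0) h)
  have hcone : ∃ v, v ∈ affineCone Z := by
    by_contra! h
    exact hX0 fun v hv => absurd hv (h v)
  have hpow : ∀ e, (X 0 ^ e : MvPolynomial (Fin (r + 1)) K) ∉ homogeneousIdeal Z := by
    intro e he
    induction e with
    | zero =>
      obtain ⟨v, hv⟩ := hcone
      simpa using he v hv
    | succ e ih =>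
      rw [pow_succ] at he
      rcases hprime e 1 _ _ (isHomogeneous_X_pow 0 e) (isHomogeneous_X K 0) he with h | h
      · exact ih h
      · exact hX0 h
  have hker : ∀ F, restrictForms Z d F = 0 ↔ F.1 ∈ homogeneousIdeal Z := by
    intro F
    rw [mem_homogeneousIdeal_iff]
    constructor
    · intro h v hv
      exact congrFun (congrArg Subtype.val h) ⟨v, hv⟩
    · intro h
      ext v
      exact h v v.2
  refine ⟨?_, ?_⟩
  · have : Module.Finite K (homogeneousSubmodule (Fin (r + 1)) K d) :=
      Module.Finite.iff_fg.2 (homogeneousSubmodule_fg _ _ _)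
    have : Module.Finite K (sections Z d) := Module.Finite.of_surjective _ hnorm
    have : Nontrivial (sections Z d) :=
      ⟨restrictForms Z d ⟨X 0 ^ d, isHomogeneous_X_pow 0 d⟩, 0, fun h => hpow d ((hker _).1 h)⟩
    exact ⟨Module.finrank K (sections Z d) - 1, ⟨Module.finBasisOfFinrankEq K _
      (Nat.sub_add_cancel Module.finrank_pos).symm⟩⟩
  intro N b
  choose f hf using fun i => hnorm (b i)
  have hfd : ∀ i, (f i).1.IsHomogeneous d := fun i => (f i).2
  have hfs : ∀ i (v : affineCone Z), (b i).1 v = eval v.1 (f i).1 := by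
    intro i v
    rw [← hf]
    rfl
  let proj : MvPolynomial (Fin (r + 1)) K →ₗ[K] homogeneousSubmodule (Fin (r + 1)) K d :=
    (homogeneousComponent d).codRestrict _ (homogeneousComponent_mem d)
  have hproj : ∀ F (hF : F.IsHomogeneous d), proj F = ⟨F, hF⟩ := fun F hF =>
    Subtype.ext (homogeneousComponent_eq_self hF)
  -- Coordinates in the basis `b` of the restriction to `Z` of the degree `d` component.
  let μ : MvPolynomial (Fin (r + 1)) K →ₗ[K] (Fin (N + 1) → K) :=
    b.equivFun.toLinearMap ∘ₗ restrictForms Z d ∘ₗ proj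
  have hμ : ∀ F, F.IsHomogeneous d → (μ F = 0 ↔ F ∈ homogeneousIdeal Z) := by
    intro F hF
    simp only [μ, LinearMap.comp_apply, hproj F hF, LinearEquiv.coe_coe,
      LinearEquiv.map_eq_zero_iff, hker]
  have hμs : ∀ F, F.IsHomogeneous d → ∀ v : affineCone Z,
      ∑ i, μ F i * eval v.1 (f i).1 = eval v.1 F := by
    intro F hF v
    have h := b.sum_equivFun (restrictForms Z d ⟨F, hF⟩)
    have h' := congrFun (congrArg Subtype.val h) v
    rw [Submodule.coe_sum, Finset.sum_apply] at h'
    simp only [μ, LinearMap.comp_apply, hproj F hF, ← hfs]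
    exact h'
  -- No base points: each `X j ^ d` is on `Z` a combination of the `b i`.
  have hs : ∀ v : affineCone Z, (fun i => (b i).1 v) ≠ 0 := by
    intro v hv
    refine v.2.1 (funext fun j => ?_)
    have h := hμs (X j ^ d) (isHomogeneous_X_pow j d) v
    simp only [← hfs, fun i => congrFun hv i, Pi.zero_apply, mul_zero, Finset.sum_const_zero,
      map_pow, eval_X] at h
    exact pow_eq_zero_iff (by omega) |>.1 h.symm
  have hJ := homogeneousIdeal_imageBySections (by omega) b (fun i => (f i).1) hfd hfs hs
  have hmem : ∀ s t h : MvPolynomial (Fin (r + 1)) K, s.IsHomogeneous 1 → t.IsHomogeneous 1 →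
      h.IsHomogeneous (d - 2) →
      linearForm K _ (μ (s * s * h)) * linearForm K _ (μ (t * t * h)) -
        linearForm K _ (μ (s * t * h)) * linearForm K _ (μ (s * t * h)) ∈
      homogeneousIdeal (imageBySections Z b) := by
    intro s t h hs ht hh
    have hdd : ∀ s t : MvPolynomial (Fin (r + 1)) K, s.IsHomogeneous 1 → t.IsHomogeneous 1 →
        (s * t * h).IsHomogeneous d := by
      intro s t hs ht
      have := (hs.mul ht).mul hh
      rwa [show 1 + 1 + (d - 2) = d by omega] at this
    rw [hJ, Ideal.mem_comap, mem_homogeneousIdeal_iff]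
    intro v hv
    have hl : ∀ F, F.IsHomogeneous d →
        eval v (aeval (fun i => (f i).1) (linearForm K _ (μ F))) = eval v F := by
      intro F hF
      rw [← hμs F hF ⟨v, hv⟩, linearForm_apply]
      simp [algebraMap_eq]
    have hl2 : ∀ F G, F.IsHomogeneous d → G.IsHomogeneous d → eval v (aeval (fun i => (f i).1)
        (linearForm K _ (μ F) * linearForm K _ (μ G))) = eval v F * eval v G := by
      intro F G hF hG
      rw [map_mul, map_mul, hl F hF, hl G hG]
    rw [map_sub, map_sub, hl2 _ _ (hdd s s hs hs) (hdd t t ht ht),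
      hl2 _ _ (hdd s t hs ht) (hdd s t hs ht)]
    simp only [map_mul]
    ring
  constructor
  · refine le_antisymm ?_ (Ideal.span_le.2 fun q hq => hq.1)
    conv_lhs => rw [hJ]
    refine comap_aeval_le_of_mem h3 hd hmd _ hfd (linearForm K _ ∘ₗ μ) ?_ _ ?_ _ hgen ?_ ?_
    · intro i
      simp only [μ, LinearMap.comp_apply, hproj _ (hfd i), hf,
        LinearEquiv.coe_coe]
      rw [linearForm_apply]
      simp
    · intro s t h hs ht hh
      exact Ideal.subset_span ⟨hmem s t h hs ht hh, exists_isQuadricOfRank_le_three h2 _ _ _⟩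
    · intro c hc
      obtain ⟨v, hv⟩ := hcone
      simpa using hc v hv
    · intro F hF hFd
      rw [LinearMap.comp_apply, (hμ F hFd).2 hF, map_zero]
  · intro k hk
    by_contra! hk3
    have hlz : ∀ a : Fin (N + 1) → K,
        aeval (fun i => (f i).1) (linearForm K _ a) ∈ homogeneousIdeal Z → a = 0 := by
      intro a ha
      have h0 : ∑ i, a i • b i = 0 := by
        ext v
        have := ha v v.2
        rw [linearForm_apply] at this
        simpa [algebraMap_eq, hfs, Submodule.coe_sum] using this
      exact funext (Fintype.linearIndependent_iff.1 b.linearIndependent a h0)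
    have hhom : ∀ a : Fin (N + 1) → K,
        (aeval (fun i => (f i).1) (linearForm K _ a)).IsHomogeneous d := by
      intro a
      rw [linearForm_apply, map_sum]
      refine IsHomogeneous.sum _ _ _ fun i _ => ?_
      rw [map_mul, aeval_X, algHom_C]
      exact (hfd i).C_mul _
    -- If rank two sufficed, every generator would be a product of two linear forms, one of them in
    -- the prime ideal and hence zero.
    have hbot : homogeneousIdeal (imageBySections Z b) = ⊥ := by
      rw [hk, Ideal.span_eq_bot]
      rintro q ⟨hq, ρ, hρ, hqρ⟩
      obtain ⟨a, c, rfl⟩ := hqρ.eq_mul (by omega)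
      rw [hJ, Ideal.mem_comap, map_mul] at hq
      rcases hprime d d _ _ (hhom a) (hhom c) hq with h | h <;> simp [hlz _ h]
    -- The quadric for `X 0`, `X 1` is then identically zero, so the linear form of `X 0 ^ (d - 1) *
    -- X 1` vanishes where that of `X 0 ^ d` does and is a multiple of it. Thus `(X 1 - k X 0) * X 0
    -- ^ (d - 1)` vanishes on `Z`, against primality and the absence of linear equations.
    have hq := hmem (X 0) (X 1) (X 0 ^ (d - 2)) (isHomogeneous_X K 0) (isHomogeneous_X K 1)
      (isHomogeneous_X_pow 0 _)
    rw [hbot, Ideal.mem_bot, sub_eq_zero] at hq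
    have h00 : (X 0 * X 0 * X 0 ^ (d - 2) : MvPolynomial (Fin (r + 1)) K) = X 0 ^ d := by
      rw [← pow_two, ← pow_add]
      congr 1
      omega
    obtain ⟨k, hk⟩ := exists_eq_smul_of_forall_sum_eq_zero
      (a := μ (X 0 * X 0 * X 0 ^ (d - 2))) (c := μ (X 0 * X 1 * X 0 ^ (d - 2)))
      (fun h => by
        rw [h00] at h
        exact hpow d ((hμ _ (isHomogeneous_X_pow 0 d)).1 h))
      (fun y hy => by
        have h := congrArg (eval y) hq
        rw [map_mul (eval y), map_mul (eval y), eval_linearForm, hy, zero_mul, eval_linearForm] at h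
        exact mul_self_eq_zero.1 h.symm)
    have hfac : (X 0 * X 1 * X 0 ^ (d - 2) - k • (X 0 * X 0 * X 0 ^ (d - 2)) :
        MvPolynomial (Fin (r + 1)) K) = (X 1 - k • X 0) * X 0 ^ (d - 1) := by
      rw [show d - 1 = d - 2 + 1 by omega, pow_succ, smul_eq_C_mul, smul_eq_C_mul]
      ring
    have hl1 : (X 1 - k • X 0 : MvPolynomial (Fin (r + 1)) K).IsHomogeneous 1 :=
      (homogeneousSubmodule _ K 1).sub_mem (isHomogeneous_X K 1)
        ((homogeneousSubmodule _ K 1).smul_mem _ (isHomogeneous_X K 0))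
    have hfd' : ((X 1 - k • X 0) * X 0 ^ (d - 1) :
        MvPolynomial (Fin (r + 1)) K).IsHomogeneous d := by
      have := hl1.mul (isHomogeneous_X_pow (R := K) (0 : Fin (r + 1)) (d - 1))
      rwa [show 1 + (d - 1) = d by omega] at this
    have hI := (hμ _ hfd').1 (by rw [← hfac, map_sub, map_smul, hk, sub_self])
    rcases hprime _ _ _ _ hl1 (isHomogeneous_X_pow _ _) hI with h | h
    · have h01 : (0 : Fin (r + 1)) ≠ 1 := by
        have : NeZero r := ⟨hr⟩
        exact Fin.zero_ne_one'
      have h := congrArg (eval (Pi.single 1 1)) (hlin _ hl1 h)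
      simp [smul_eval, h01] at h
    · exact hpow _ h

end Embedding

/-! ### Sections of `O(d)` on projective space are forms. -/

section ProjectiveSpace

open MvPolynomial

theorem MvPolynomial.IsHomogeneous.of_mul_left {σ K : Type*} [Field K] {F G : MvPolynomial σ K}
    {e : ℕ} (h : (F * G).IsHomogeneous e) (h0 : F * G ≠ 0) : ∃ a, F.IsHomogeneous a := by
  -- Scaling all variables by `T` makes the degree `j` component the coefficient of `T ^ j`. Highest
  -- and lowest degrees in `T` add under products, so they coincide for each factor of a monomial in
  -- `T`.
  let φ : MvPolynomial σ K →ₐ[K] Polynomial (MvPolynomial σ K) :=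
    MvPolynomial.aeval fun i => Polynomial.C (X i) * Polynomial.X
  have hφ : ∀ F j, (φ F).coeff j = homogeneousComponent j F := by
    intro F j
    induction F using MvPolynomial.induction_on' with
    | add p q hp hq => rw [map_add, Polynomial.coeff_add, hp, hq, map_add]
    | monomial α c =>
      have : φ (monomial α c) = Polynomial.C (monomial α c) * Polynomial.X ^ α.degree := by
        simp only [φ, aeval_monomial]
        simp only [mul_pow, Finsupp.prod, Finset.prod_mul_distrib]
        rw [Finset.prod_pow_eq_pow_sum, ← Finsupp.degree_apply, ← mul_assoc, monomial_eq,
          map_mul, Finsupp.prod, map_prod]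
        simp only [map_pow]
        rfl
      rw [this, Polynomial.coeff_C_mul_X_pow,
        homogeneousComponent_of_mem (isHomogeneous_monomial c rfl)]
  have hFG : φ F * φ G = Polynomial.C (F * G) * Polynomial.X ^ e := by
    rw [← map_mul]
    ext1 j
    rw [hφ, homogeneousComponent_of_mem h, Polynomial.coeff_C_mul_X_pow]
  have hFG0 : φ F * φ G ≠ 0 := by
    rw [hFG]
    exact mul_ne_zero (Polynomial.C_ne_zero.2 h0) (pow_ne_zero _ Polynomial.X_ne_zero)
  have hF0 := left_ne_zero_of_mul hFG0
  have hG0 := right_ne_zero_of_mul hFG0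
  have h1 := Polynomial.natDegree_mul hF0 hG0
  have h2 := Polynomial.natTrailingDegree_mul hF0 hG0
  rw [hFG, Polynomial.natDegree_C_mul_X_pow _ _ h0] at h1
  rw [hFG, Polynomial.C_mul_X_pow_eq_monomial, Polynomial.natTrailingDegree_monomial h0] at h2
  have h3 := (φ F).natTrailingDegree_le_natDegree
  have h4 := (φ G).natTrailingDegree_le_natDegree
  have h5 : F = homogeneousComponent (φ F).natDegree F := by
    conv_lhs => rw [← sum_homogeneousComponent F]
    refine Finset.sum_eq_single_of_mem _ ?_ fun j _ hj => ?_
    · rw [Finset.mem_range, Nat.lt_succ_iff]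
      by_contra! hlt
      have := homogeneousComponent_eq_zero _ F hlt
      rw [← hφ, Polynomial.coeff_natDegree, Polynomial.leadingCoeff_eq_zero] at this
      exact hF0 this
    · rw [← hφ]
      rcases lt_or_gt_of_ne hj with hj | hj
      · exact Polynomial.coeff_eq_zero_of_lt_natTrailingDegree (by omega)
      · exact Polynomial.coeff_eq_zero_of_natDegree_lt hj
  have h6 := homogeneousComponent_isHomogeneous (φ F).natDegree F
  rw [← h5] at h6
  exact ⟨_, h6⟩

variable {K : Type*} [Field K] {r : ℕ}

theorem mem_affineCone_univ {v : Fin (r + 1) → K} :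
    v ∈ affineCone (Set.univ : Set (PSpace K r)) ↔ v ≠ 0 :=
  ⟨fun h => h.1, fun h => ⟨h, Set.mem_univ _⟩⟩

theorem eq_zero_of_eval_eq_zero_of_ne_zero [Infinite K] {F : MvPolynomial (Fin (r + 1)) K}
    (h : ∀ v, v ≠ 0 → eval v F = 0) : F = 0 := by
  have h1 : F * X 0 = 0 := by
    refine MvPolynomial.funext fun v => ?_
    by_cases hv : v = 0
    · simp [hv]
    · simp [h v hv]
  exact (mul_eq_zero.1 h1).resolve_right (X_ne_zero 0)

theorem homogeneousIdeal_univ [Infinite K] :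
    homogeneousIdeal (Set.univ : Set (PSpace K r)) = ⊥ := by
  rw [eq_bot_iff]
  intro F hF
  exact eq_zero_of_eval_eq_zero_of_ne_zero fun v hv => hF v (mem_affineCone_univ.2 hv)

/-- A form without nontrivial zeros in at least two variables is constant. -/
theorem MvPolynomial.IsHomogeneous.degree_eq_zero_of_forall_eval_ne_zero [IsAlgClosed K]
    (h2 : (2 : K) ≠ 0) (hr : r ≠ 0) {G : MvPolynomial (Fin (r + 1)) K} {k : ℕ}
    (hG : G.IsHomogeneous k) (h : ∀ v, v ≠ 0 → eval v G ≠ 0) : k = 0 := by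
  by_contra hk
  have : NeZero r := ⟨hr⟩
  have h01 : (0 : Fin (r + 1)) ≠ 1 := Fin.zero_ne_one'
  have hconst : ∀ a b : Fin (r + 1) → K, (∀ t : K, a + t • b ≠ 0) →
      ∀ t : K, eval (a + t • b) G = eval a G := by
    intro a b hab t
    let p : Polynomial K :=
      MvPolynomial.aeval (fun i => Polynomial.C (a i) + Polynomial.X * Polynomial.C (b i)) G
    have hp : ∀ t, p.eval t = eval (a + t • b) G := by
      intro t
      have h := comp_aeval_apply (fun i => Polynomial.C (a i) + Polynomial.X * Polynomial.C (b i))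
        (Polynomial.aeval t) G
      rw [Polynomial.coe_aeval_eq_eval] at h
      rw [h, aeval_eq_eval]
      congr 2
      ext i
      simp only [Polynomial.eval_add, Polynomial.eval_mul, Polynomial.eval_C, Polynomial.eval_X,
        Pi.add_apply, Pi.smul_apply, smul_eq_mul]
    have hdeg : p.degree = 0 := by
      by_contra hdeg
      obtain ⟨x, hx⟩ := IsAlgClosed.exists_root p hdeg
      exact h _ (hab x) ((hp x).symm.trans hx)
    rw [← hp, Polynomial.eq_C_of_degree_eq_zero hdeg, Polynomial.eval_C,
      ← Polynomial.eval_C (x := (0 : K)) (a := p.coeff 0), ← Polynomial.eq_C_of_degree_eq_zero hdeg,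
      hp, zero_smul, add_zero]
  let a : Fin (r + 1) → K := Pi.single 0 1
  let b : Fin (r + 1) → K := Pi.single 1 1
  have hab : ∀ t : K, a + t • b ≠ 0 := fun t ht => by
    simpa [a, b, h01] using congrFun ht 0
  have hba : ∀ t : K, b + t • a ≠ 0 := fun t ht => by
    simpa [a, b, h01.symm] using congrFun ht 1
  -- `G` is constant on the lines `a + t b` and `b + t a`. The parameter 1 gives `G a = G b`, while
  -- `t ^ k = -1` gives `G a = -G b`, so `2 * G a = 0`.
  obtain ⟨t, ht⟩ := IsAlgClosed.exists_pow_nat_eq (-1 : K) (Nat.pos_of_ne_zero hk)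
  have ht0 : t ≠ 0 := by
    rintro rfl
    simp [hk] at ht
  have e1 := hconst a b hab t
  have e2 := hconst b a hba t⁻¹
  have e3 := hconst a b hab 1
  have e4 := hconst b a hba 1
  rw [show a + t • b = t • (b + t⁻¹ • a) by
    rw [smul_add, smul_inv_smul₀ ht0, add_comm a], hG.eval_smul, e2, ht] at e1
  rw [one_smul] at e3 e4
  rw [add_comm a, e4] at e3
  refine h a (by simpa using hab 0) ?_
  rw [e3] at e1
  exact (mul_eq_zero.1 (show 2 * eval a G = 0 by linear_combination -e1)).resolve_left h2

/-- Write a section near one point as `F / G` in lowest terms. By unique factorization `G` divides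
every other local denominator, so it has no zeros and is constant. -/
theorem isNormalInDegree_univ [IsAlgClosed K] (h2 : (2 : K) ≠ 0) (hr : r ≠ 0) (d : ℕ) :
    IsNormalInDegree (Set.univ : Set (PSpace K r)) d := by
  intro s
  have hcone : ∀ v : Fin (r + 1) → K, v ≠ 0 → v ∈ affineCone (Set.univ : Set (PSpace K r)) :=
    fun v hv => mem_affineCone_univ.2 hv
  obtain ⟨e, F₀, G₀, hF₀, hG₀, hv₀, h₀⟩ := s.2 ⟨Pi.single 0 1, hcone _ (by simp)⟩
  have hG₀0 : G₀ ≠ 0 := by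
    rintro rfl
    simp at hv₀
  obtain ⟨G, F, H, hrel, rfl, rfl⟩ :=
    UniqueFactorizationMonoid.exists_reduced_factors G₀ hG₀0 F₀
  have hH0 := left_ne_zero_of_mul hG₀0
  have hG0 := right_ne_zero_of_mul hG₀0
  have hcross : ∀ (F' G' : MvPolynomial (Fin (r + 1)) K), G' ≠ 0 →
      (∀ w : affineCone (Set.univ : Set (PSpace K r)), eval w.1 G' ≠ 0 →
        s.1 w = eval w.1 F' / eval w.1 G') → F * G' = F' * G := by
    intro F' G' hG' h'
    -- The extra factors make the identity hold also where a denominator vanishes; they are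
    -- cancelled afterwards.
    have h1 : (F * G' - F' * G) * (H * G) * G' * H = 0 := by
      refine eq_zero_of_eval_eq_zero_of_ne_zero fun w hw => ?_
      by_cases hw1 : eval w (H * G) = 0
      · rw [map_mul, map_mul, map_mul _ _ (H * G), hw1]
        ring
      by_cases hw2 : eval w G' = 0
      · rw [map_mul, map_mul, hw2]
        ring
      have e1 := h₀ ⟨w, hcone w hw⟩ hw1
      have e2 := h' ⟨w, hcone w hw⟩ hw2
      rw [e1, div_eq_div_iff hw1 hw2] at e2
      simp only [map_mul, map_sub] at e2 ⊢
      linear_combination (eval w H * eval w G * eval w G') * e2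
    have h3 := (mul_eq_zero.1 h1).resolve_right hH0
    have h4 := (mul_eq_zero.1 h3).resolve_right hG'
    exact sub_eq_zero.1 ((mul_eq_zero.1 h4).resolve_right hG₀0)
  have hlocal : ∀ v : affineCone (Set.univ : Set (PSpace K r)),
      eval v.1 G ≠ 0 ∧ s.1 v = eval v.1 F / eval v.1 G := by
    intro v
    obtain ⟨e', F', G', -, -, hv', h'⟩ := s.2 v
    have hc := hcross F' G' (by rintro rfl; simp at hv') h'
    obtain ⟨D, hD⟩ := hrel.dvd_of_dvd_mul_left (z := G') ⟨F', by rw [hc, mul_comm]⟩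
    have hGv : eval v.1 G ≠ 0 := by
      intro h
      rw [hD, map_mul, h, zero_mul] at hv'
      exact hv' rfl
    refine ⟨hGv, ?_⟩
    rw [h' v hv', div_eq_div_iff hv' hGv, ← map_mul, ← map_mul, hc]
  obtain ⟨k, hGk⟩ := (mul_comm H G ▸ hG₀).of_mul_left (mul_comm H G ▸ hG₀0)
  obtain ⟨l, hHl⟩ := hG₀.of_mul_left hG₀0
  obtain rfl := hGk.degree_eq_zero_of_forall_eval_ne_zero h2 hr fun v hv => (hlocal ⟨v, hcone v hv⟩).1
  have hle : l = e := by simpa using (hHl.mul hGk).inj_right hG₀ hG₀0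
  have hFd : F.IsHomogeneous d := by
    by_cases hF0 : F = 0
    · rw [hF0]
      exact isHomogeneous_zero _ _ _
    · obtain ⟨j, hFj⟩ := (mul_comm H F ▸ hF₀).of_mul_left
        (mul_comm H F ▸ mul_ne_zero hH0 hF0)
      have := (hHl.mul hFj).inj_right hF₀ (mul_ne_zero hH0 hF0)
      rwa [show j = d by omega] at hFj
  have hGc : G = C (coeff 0 G) := by
    rw [← homogeneousComponent_zero, homogeneousComponent_eq_self hGk]
  refine ⟨⟨C (coeff 0 G)⁻¹ * F, hFd.C_mul _⟩, ?_⟩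
  ext v
  rw [(hlocal v).2]
  have : eval v.1 G = coeff 0 G := by rw [hGc]; simp
  rw [this, div_eq_inv_mul]
  simp [restrictForms]

end ProjectiveSpace

/-! ### Irreducibility, and the two claims. -/

section Main

open MvPolynomial

variable {K : Type*} [Field K] {r : ℕ}

theorem IsProjectiveVariety.mem_or_mem {X : Set (PSpace K r)} (hX : IsProjectiveVariety X)
    {e e' : ℕ} {F G : MvPolynomial (Fin (r + 1)) K} (hF : F.IsHomogeneous e)
    (hG : G.IsHomogeneous e') (hFG : F * G ∈ homogeneousIdeal X) :
    F ∈ homogeneousIdeal X ∨ G ∈ homogeneousIdeal X := by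
  let V : MvPolynomial (Fin (r + 1)) K → Set (PSpace K r) := fun F =>
    {p | ∀ F' ∈ ({F} : Set (MvPolynomial (Fin (r + 1)) K)), ∀ v ∈ affineCone {p}, eval v F' = 0}
  have hclosed : ∀ (e : ℕ) (F : MvPolynomial (Fin (r + 1)) K), F.IsHomogeneous e →
      IsZariskiClosed (V F) := fun e F hF => ⟨{F}, by rintro _ rfl; exact ⟨e, hF⟩, rfl⟩
  have hV : ∀ (e : ℕ) (F : MvPolynomial (Fin (r + 1)) K), F.IsHomogeneous e →
      ∀ p : PSpace K r, eval p.rep F = 0 → p ∈ V F := by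
    rintro e F hF p hp _ rfl v ⟨hv, hvp⟩
    rw [Set.mem_singleton_iff, ← p.mk_rep] at hvp
    obtain ⟨t, rfl⟩ := (Projectivization.mk_eq_mk_iff' K _ _ _ _).1 hvp
    rw [hF.eval_smul, hp, mul_zero]
  have hVI : ∀ F : MvPolynomial (Fin (r + 1)) K, X ⊆ V F → F ∈ homogeneousIdeal X := by
    rintro F h v ⟨hv, hvX⟩
    exact h hvX F rfl v ⟨hv, rfl⟩
  refine (hX.irreducible _ _ (hclosed e F hF) (hclosed e' G hG) fun p hp => ?_).imp
    (hVI F) (hVI G)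
  have h := hFG p.rep ⟨p.rep_nonzero, by rwa [p.mk_rep]⟩
  rw [map_mul, mul_eq_zero] at h
  exact h.imp (hV e F hF p) (hV e' G hG p)

theorem PSpace.subsingleton_zero (K : Type*) [Field K] : Subsingleton (PSpace K 0) := by
  refine ⟨fun p q => ?_⟩
  have hq : q.rep 0 ≠ 0 := fun h => q.rep_nonzero (funext fun i => by
    rw [Fin.fin_one_eq_zero i]; exact h)
  rw [← p.mk_rep, ← q.mk_rep]
  refine (Projectivization.mk_eq_mk_iff' K _ _ _ _).2 ⟨p.rep 0 / q.rep 0, funext fun i => ?_⟩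
  rw [Fin.fin_one_eq_zero i, Pi.smul_apply, smul_eq_mul, div_mul_cancel₀ _ hq]

end Main

theorem theorem1p2 (K : Type*) [Field K] [IsAlgClosed K] [CharP K 3] :
    (∀ n d : ℕ, 2 ≤ n → 3 ≤ d → HasRankIndex (Set.univ : Set (PSpace K n)) d 3) ∧
      (∀ (r : ℕ) (X : Set (PSpace K r)), IsProjectiveVariety X → X.Nontrivial →
        IsLinearlyNormallyEmbedded X →
        ∀ m : ℕ, 3 ≤ m → (∀ j : ℕ, m ≤ j → IsNormalInDegree X j) →
          IdealGeneratedInDegreeLE X m →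
          ∀ d : ℕ, m ≤ d → HasRankIndex X d 3) := by
  have h3 : (3 : K) = 0 := by exact_mod_cast CharP.cast_eq_zero K 3
  have h2 : (2 : K) ≠ 0 := by
    intro h2
    exact one_ne_zero (α := K) (by linear_combination h3 - h2)
  refine ⟨fun n d hn hd => ?_, fun r X hX hX2 hL m hm hnorm hgen d hd => ?_⟩
  · have : Infinite K := IsAlgClosed.instInfinite
    -- The ideal of the whole space is zero, so the generation bound `m = 3` serves.
    refine hasRankIndex_three h3 (by omega) (fun _ _ F G _ _ h => ?_) (fun F _ h => ?_) hd hd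
      (isNormalInDegree_univ h2 (by omega) d) ?_
    · rw [homogeneousIdeal_univ] at h ⊢
      exact mul_eq_zero.1 h
    · rwa [homogeneousIdeal_univ] at h
    · rw [IdealGeneratedInDegreeLE, homogeneousIdeal_univ]
      exact (Ideal.span_eq_bot.2 fun F hF => hF.1).symm
  · refine hasRankIndex_three h3 ?_ (fun _ _ F G hF hG h => hX.mem_or_mem hF hG h) (fun F hF h => ?_)
      (hm.trans hd) hd (hnorm d hd) hgen
    · rintro rfl
      have := PSpace.subsingleton_zero K
      exact Set.not_subsingleton_iff.2 hX2 Set.subsingleton_of_subsingleton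
    · have h0 : restrictForms X 1 ⟨F, hF⟩ = restrictForms X 1 0 := by
        ext v
        simpa [restrictForms] using h v v.2
      exact congrArg Subtype.val (hL.1 h0)
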